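/- Let $G\rightrightarrows M$ be a Lie groupoid with source $s$ and target $t$ (finite-dimensional smooth manifolds without boundary, $M$ Hausdorff and second countable). A *$G$-path* from $x$ to $y$ is a sequence $\sigma=\sigma_n g_n\sigma_{n-1}\cdots g_1\sigma_0$ of piecewise smooth paths $\sigma_k:[0,1]\to M$ and arrows $g_k$ from $\sigma_{k-1}(1)$ to $\sigma_k(0)$, with $\sigma_0(0)=x$, $\sigma_n(1)=y$; it is a *$G$-loop* at $x_0$ if $x=y=x_0$. Assume that $G$ is $G$-connected (any two points of $M$ are joined by a $G$-path) and fix $x_0\in M$. A map $f$ on $M$ is *basic* if $f\circ s=f\circ t$, and a smooth $1$-form $\omega$ on $M$ is *basic* if $s^*\omega=t^*\omega$; $H^1_{\rm bas}(G,\mathbb R)$ is the space of closed basic $1$-forms modulo the differentials $dh$ of smooth basic functions $h:M\to\mathbb R$. Put $\int_\sigma\omega=\sum_{k=0}^n\int_{\sigma_k}\omega$. Let $H_1(G,\mathbb Z)$ be the first total singular homology group of $G$, i.e. the first homology of the total complex of the double complex $C_q(G^{(n)})$ of singular chains on the nerve of $G$, and let $|\sigma|=\left[\sum_k\sigma_k+\sum_k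 g_k\right]\in H_1(G,\mathbb Z)$ be the class of a $G$-loop $\sigma$. A class $\xi\in H^1_{\rm bas}(G,\mathbb R)$ is *integral* if its $G$-homomorphism of periods takes integer values, that is, if there is a homomorphism $\mathrm{Per}_\xi:H_1(G,\mathbb Z)\to\mathbb R$ with $\mathrm{Per}_\xi(|\sigma|)=\int_\sigma\eta$ for all closed basic $\eta$ in the class $\xi$ and all $G$-loops $\sigma$ at $x_0$, and with $\mathrm{Per}_\xi(H_1(G,\mathbb Z))\subset\mathbb Z$. Let $d\theta=\frac{1}{2\pi}(x\,dy-y\,dx)$ be the angle form on $S^1$, so that $\int_{S^1}d\theta=1$. **Proposition.** Let $\omega$ be a closed basic $1$-form on $M$ and $\xi=[\omega]\in H^1_{\rm bas}(G,\mathbb R)$ its basic cohomology class. The following are equivalent: 1. $\omega=f^*(d\theta)$ for some smooth basic map $f:M\to S^1$; 2. $\xi$ is integral; 3. all $G$-periods of $\omega$ over $G$-loops are integers: $\int_\sigma\omega\in\mathbb Z$ for every $G$-loop $\sigma$ at $x_0$. -/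

import Mathlib

open Set
open scoped Manifold ContDiff Topology

noncomputable section

namespace LieGpd

section Forms

variable {E : Type*} [NormedAddCommGroup E] [NormedSpace ℝ E]
  {M : Type*} [TopologicalSpace M] [ChartedSpace E M] [IsManifold 𝓘(ℝ, E) ∞ M]

/-- Smooth `1`-forms on `M`: smooth sections of the cotangent bundle. -/
abbrev OneForm (E : Type*) [NormedAddCommGroup E] [NormedSpace ℝ E]
    (M : Type*) [TopologicalSpace M] [ChartedSpace E M] [IsManifold 𝓘(ℝ, E) ∞ M] :=
  Cₛ^∞⟮𝓘(ℝ, E); E →L[ℝ] ℝ, fun x : M => TangentSpace 𝓘(ℝ, E) x →L[ℝ] Bundle.Trivial M ℝ x⟯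

/-- The covector of the form `η` at `x`. -/
def OneForm.at (η : OneForm E M) (x : M) : TangentSpace 𝓘(ℝ, E) x →L[ℝ] ℝ := η x

/-- The coordinate expression of a `1`-form in the chart at `c`: the pullback of `η` under the
inverse of that chart. -/
def OneForm.inChart (η : OneForm E M) (c : M) (y : E) : E →L[ℝ] ℝ :=
  (η.at ((extChartAt 𝓘(ℝ, E) c).symm y)).comp
    (mfderiv 𝓘(ℝ, E) 𝓘(ℝ, E) (extChartAt 𝓘(ℝ, E) c).symm y)

/-- `dη = 0`, that is, in every chart the derivative `∂_v η(w)` is symmetric in `v` and `w`. -/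
def OneForm.IsClosed (η : OneForm E M) : Prop :=
  ∀ c : M, ∀ y ∈ (extChartAt 𝓘(ℝ, E) c).target, ∀ v w : E,
    fderiv ℝ (η.inChart c) y v w = fderiv ℝ (η.inChart c) y w v

lemma OneForm.differentiableAt_inChart [FiniteDimensional ℝ E] (η : OneForm E M) (c : M) {y : E}
    (hy : y ∈ (extChartAt 𝓘(ℝ, E) c).target) : DifferentiableAt ℝ (η.inChart c) y := by
  have ho : IsOpen (extChartAt 𝓘(ℝ, E) c).target := isOpen_extChartAt_target c
  have hφ : ContMDiffOn 𝓘(ℝ, E) 𝓘(ℝ, E) ∞ (extChartAt 𝓘(ℝ, E) c).symm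
      (extChartAt 𝓘(ℝ, E) c).target := contMDiffOn_extChartAt_symm c
  have key : ContDiffOn ℝ ∞ (η.inChart c) (extChartAt 𝓘(ℝ, E) c).target := by
    rw [contDiffOn_clm_apply]
    intro v z hz
    have hv : ContMDiffAt 𝓘(ℝ, E) (𝓘(ℝ, E).prod 𝓘(ℝ, E)) ∞
        (fun y : E => (Bundle.TotalSpace.mk' E y v : TangentBundle 𝓘(ℝ, E) E)) z := by
      rw [Bundle.contMDiffAt_totalSpace]
      exact ⟨contMDiffAt_id, by simpa using! contMDiffAt_const⟩
    have hT := (hφ.contMDiffOn_tangentMapWithin (m := ∞) (by simp) ho.uniqueMDiffOn)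
    have h1 : ContMDiffAt 𝓘(ℝ, E) (𝓘(ℝ, E).prod 𝓘(ℝ, E)) ∞
        (fun y : E => (Bundle.TotalSpace.mk' E ((extChartAt 𝓘(ℝ, E) c).symm y)
          (mfderiv 𝓘(ℝ, E) 𝓘(ℝ, E) (extChartAt 𝓘(ℝ, E) c).symm y v) :
            TangentBundle 𝓘(ℝ, E) M)) z := by
      have h2 := (hT.contMDiffAt (x := (⟨z, v⟩ : TangentBundle 𝓘(ℝ, E) E))
        ((ho.preimage (FiberBundle.continuous_proj E _)).mem_nhds hz)).comp z hv
      refine h2.congr_of_eventuallyEq ?_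
      filter_upwards [ho.mem_nhds hz] with y hy
      change Bundle.TotalSpace.mk' E _ _ = Bundle.TotalSpace.mk' E _ _
      rw [← mfderivWithin_of_isOpen ho hy]
    have h3 : ContMDiffAt 𝓘(ℝ, E) (𝓘(ℝ, E).prod 𝓘(ℝ, E →L[ℝ] ℝ)) ∞
        (fun y : E => Bundle.TotalSpace.mk' (E →L[ℝ] ℝ)
          (E := fun x : M => TangentSpace 𝓘(ℝ, E) x →L[ℝ] Bundle.Trivial M ℝ x)
          ((extChartAt 𝓘(ℝ, E) c).symm y) (η ((extChartAt 𝓘(ℝ, E) c).symm y))) z :=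
      (η.contMDiff _).comp z (hφ.contMDiffAt (ho.mem_nhds hz))
    have h4 := h3.clm_bundle_apply h1
    rw [Bundle.contMDiffAt_totalSpace] at h4
    exact (h4.2.contDiffAt).contDiffWithinAt
  exact (key.contDiffAt (ho.mem_nhds hy)).differentiableAt (by simp)

lemma OneForm.inChart_add (η₁ η₂ : OneForm E M) (c : M) :
    (η₁ + η₂).inChart c = η₁.inChart c + η₂.inChart c := rfl

lemma OneForm.inChart_smul (a : ℝ) (η : OneForm E M) (c : M) :
    (a • η).inChart c = a • η.inChart c := rfl

lemma OneForm.inChart_zero (c : M) : (0 : OneForm E M).inChart c = 0 := by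
  ext; rfl

end Forms

section Paths

variable {E : Type*} [NormedAddCommGroup E] [NormedSpace ℝ E]
  {M : Type*} [TopologicalSpace M] [ChartedSpace E M]

/-- A path `[0, 1] → M` is piecewise smooth if it is smooth on each closed interval of some
finite subdivision of `[0, 1]`. -/
def IsPiecewiseSmooth (E : Type*) [NormedAddCommGroup E] [NormedSpace ℝ E]
    {M : Type*} [TopologicalSpace M] [ChartedSpace E M] {x y : M} (γ : Path x y) : Prop :=
  ∃ (n : ℕ) (τ : ℕ → ℝ), Monotone τ ∧ τ 0 = 0 ∧ τ n = 1 ∧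
    ∀ i < n, ContMDiffOn 𝓘(ℝ, ℝ) 𝓘(ℝ, E) ∞ γ.extend (Icc (τ i) (τ (i + 1)))

/-- The line integral `∫_γ η` of a `1`-form. -/
def OneForm.pathIntegral [IsManifold 𝓘(ℝ, E) ∞ M] (η : OneForm E M) {x y : M} (γ : Path x y) : ℝ :=
  ∫ r in (0 : ℝ)..1, η.at (γ.extend r) (mfderiv 𝓘(ℝ, ℝ) 𝓘(ℝ, E) γ.extend r (1 : ℝ))

end Paths

section Circle

attribute [local instance] finrank_real_complex_fact'

/-- The angle form `dθ` on the unit circle, `θ = φ / 2π`: at `z = e^{iφ}`, a tangent vector `v` is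
sent to `(1 / 2π) Im (conj z * v)`, which is `(x dy - y dx) / 2π`. -/
def angleForm (z : Circle) : TangentSpace (𝓡 1) z →L[ℝ] ℝ :=
  (2 * Real.pi)⁻¹ • (Complex.imCLM.comp
    ((ContinuousLinearMap.mul ℝ ℂ (starRingEnd ℂ (z : ℂ))).comp
      (mvfderiv (𝓡 1) (fun w : Circle => (w : ℂ)) z)))

/-- `η = f^* dθ` for the map `f : M → S¹`. -/
def IsPullbackAngle {E : Type*} [NormedAddCommGroup E] [NormedSpace ℝ E]
    {M : Type*} [TopologicalSpace M] [ChartedSpace E M] [IsManifold 𝓘(ℝ, E) ∞ M]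
    (η : OneForm E M) (f : M → Circle) : Prop :=
  ∀ x, η.at x = (angleForm (f x)).comp (mfderiv 𝓘(ℝ, E) (𝓡 1) f x)

end Circle

/-- A Lie groupoid `G ⇉ M`, with `M` and `G` modelled on `E` and `F`. The product `mul g h`
is only meaningful for composable arrows, `s g = t h`. -/
structure LieGroupoid (E : Type*) [NormedAddCommGroup E] [NormedSpace ℝ E]
    (M : Type*) [TopologicalSpace M] [ChartedSpace E M]
    (F : Type*) [NormedAddCommGroup F] [NormedSpace ℝ F]
    (G : Type*) [TopologicalSpace G] [ChartedSpace F G] where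
  s : G → M
  t : G → M
  mul : G → G → G
  unit : M → G
  inv : G → G
  submersion_s : Manifold.IsSubmersion 𝓘(ℝ, F) 𝓘(ℝ, E) ∞ s
  submersion_t : Manifold.IsSubmersion 𝓘(ℝ, F) 𝓘(ℝ, E) ∞ t
  smooth_mul : ContMDiffOn (𝓘(ℝ, F).prod 𝓘(ℝ, F)) 𝓘(ℝ, F) ∞ (fun p : G × G => mul p.1 p.2)
    {p : G × G | s p.1 = t p.2}
  smooth_unit : ContMDiff 𝓘(ℝ, E) 𝓘(ℝ, F) ∞ unit
  smooth_inv : ContMDiff 𝓘(ℝ, F) 𝓘(ℝ, F) ∞ inv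
  s_unit : ∀ x, s (unit x) = x
  t_unit : ∀ x, t (unit x) = x
  s_mul : ∀ g h, s g = t h → s (mul g h) = s h
  t_mul : ∀ g h, s g = t h → t (mul g h) = t g
  mul_assoc : ∀ g h k, s g = t h → s h = t k → mul (mul g h) k = mul g (mul h k)
  unit_mul : ∀ g, mul (unit (t g)) g = g
  mul_unit : ∀ g, mul g (unit (s g)) = g
  s_inv : ∀ g, s (inv g) = t g
  t_inv : ∀ g, t (inv g) = s g
  inv_mul : ∀ g, mul (inv g) g = unit (s g)
  mul_inv : ∀ g, mul g (inv g) = unit (t g)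

namespace LieGroupoid

variable {E : Type*} [NormedAddCommGroup E] [NormedSpace ℝ E]
  {M : Type*} [TopologicalSpace M] [ChartedSpace E M]
  {F : Type*} [NormedAddCommGroup F] [NormedSpace ℝ F]
  {G : Type*} [TopologicalSpace G] [ChartedSpace F G]
  (Γ : LieGroupoid E M F G)

/-! ### Basic forms and basic cohomology -/

/-- A map `f` on `M` is basic if `f ∘ s = f ∘ t`. -/
def IsBasicMap {X : Type*} (f : M → X) : Prop := ∀ g : G, f (Γ.s g) = f (Γ.t g)

section Basic

variable [IsManifold 𝓘(ℝ, E) ∞ M]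

/-- A `1`-form `η` on `M` is basic if `s^* η = t^* η`. -/
def IsBasicForm (η : OneForm E M) : Prop :=
  ∀ g : G, (η.at (Γ.s g)).comp (mfderiv 𝓘(ℝ, F) 𝓘(ℝ, E) Γ.s g) =
    (η.at (Γ.t g)).comp (mfderiv 𝓘(ℝ, F) 𝓘(ℝ, E) Γ.t g)

/-- The space of closed basic `1`-forms. -/
def closedBasicForms [FiniteDimensional ℝ E] : Submodule ℝ (OneForm E M) where
  carrier := {η | η.IsClosed ∧ Γ.IsBasicForm η}
  zero_mem' := by
    refine ⟨fun c y _ v w => ?_, fun g => ?_⟩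
    · simp [OneForm.inChart_zero]
    · rfl
  add_mem' := by
    rintro η₁ η₂ ⟨h₁, b₁⟩ ⟨h₂, b₂⟩
    refine ⟨fun c y hy v w => ?_, fun g => ?_⟩
    · rw [OneForm.inChart_add, fderiv_add (η₁.differentiableAt_inChart c hy)
        (η₂.differentiableAt_inChart c hy)]
      simp [h₁ c y hy v w, h₂ c y hy v w]
    · exact congrArg₂ (· + ·) (b₁ g) (b₂ g)
  smul_mem' := by
    rintro a η ⟨h, b⟩
    refine ⟨fun c y hy v w => ?_, fun g => ?_⟩
    · rw [OneForm.inChart_smul, fderiv_const_smul (η.differentiableAt_inChart c hy)]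
      simp [h c y hy v w]
    · exact congrArg (a • ·) (b g)

/-- The space of differentials `df` of smooth basic functions `f : M → ℝ`. -/
def exactBasicForms : Submodule ℝ (OneForm E M) where
  carrier := {η | ∃ f : M → ℝ, ContMDiff 𝓘(ℝ, E) 𝓘(ℝ, ℝ) ∞ f ∧ Γ.IsBasicMap f ∧
    ∀ x, η.at x = mvfderiv 𝓘(ℝ, E) f x}
  zero_mem' := ⟨0, contMDiff_const, fun _ => rfl, fun x => by rw [mvfderiv_zero]; rfl⟩
  add_mem' := by
    rintro η₁ η₂ ⟨f₁, h₁, b₁, e₁⟩ ⟨f₂, h₂, b₂, e₂⟩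
    refine ⟨f₁ + f₂, h₁.add h₂, fun g => congrArg₂ (· + ·) (b₁ g) (b₂ g), fun x => ?_⟩
    rw [mvfderiv_add (h₁.mdifferentiableAt (by simp)) (h₂.mdifferentiableAt (by simp)),
      ← e₁, ← e₂]
    rfl
  smul_mem' := by
    rintro a η ⟨f, h, b, e⟩
    have ha : ContMDiff 𝓘(ℝ, E) 𝓘(ℝ, ℝ) ∞ (fun _ : M => a) := contMDiff_const
    refine ⟨(fun _ : M => a) • f, ha.smul h, fun g => congrArg (a • ·) (b g),
      fun x => ?_⟩
    rw [mvfderiv_smul mdifferentiableAt_const (h.mdifferentiableAt (by simp)),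
      mvfderiv_const, ← e]
    ext v
    simp
    rfl

/-- The first basic cohomology `H¹_bas(G, ℝ)`. -/
abbrev BasicH1 [FiniteDimensional ℝ E] : Type _ :=
  Γ.closedBasicForms ⧸ (Γ.exactBasicForms.submoduleOf Γ.closedBasicForms)

/-- The basic cohomology class of a closed basic `1`-form. -/
def basicClass [FiniteDimensional ℝ E] (η : Γ.closedBasicForms) : Γ.BasicH1 :=
  Submodule.Quotient.mk η

end Basic

/-! ### `G`-paths -/

/-- A `G`-path `σ_n g_n σ_{n-1} ⋯ g_1 σ_0` from `x` to `y`: each `σ_k` is a piecewise smooth path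
in `M`, each `g_k` is an arrow from the end of `σ_{k-1}` to the start of `σ_k`. -/
inductive GPath : M → M → Type _
  | path {x y : M} (γ : Path x y) (hγ : IsPiecewiseSmooth E γ) : GPath x y
  | snoc {x y z w : M} (σ : GPath x y) (g : G) (hs : Γ.s g = y) (ht : Γ.t g = z)
      (γ : Path z w) (hγ : IsPiecewiseSmooth E γ) : GPath x w

/-- Any two points of `M` are joined by a `G`-path. -/
def GConnected : Prop := ∀ x y : M, Nonempty (Γ.GPath x y)

variable {Γ} in
/-- The `G`-path integral `∫_σ η = ∑ ∫_{σ_k} η`. -/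
def GPath.integral [IsManifold 𝓘(ℝ, E) ∞ M] (η : OneForm E M) {x y : M} : Γ.GPath x y → ℝ
  | .path γ _ => η.pathIntegral γ
  | .snoc σ _ _ _ γ _ => GPath.integral η σ + η.pathIntegral γ

end LieGroupoid

/-! ### Total singular homology in degree one -/

section Singular

variable {X Y : Type*} [TopologicalSpace X] [TopologicalSpace Y]

/-- Singular `q`-chains of `X` with integer coefficients. -/
abbrev SChain (q : ℕ) (X : Type*) [TopologicalSpace X] : Type _ :=
  C(stdSimplex ℝ (Fin (q + 1)), X) →₀ ℤ

/-- The `j`-th face inclusion of the standard simplex. -/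
def faceMap (q : ℕ) (j : Fin (q + 2)) :
    C(stdSimplex ℝ (Fin (q + 1)), stdSimplex ℝ (Fin (q + 2))) :=
  ⟨stdSimplex.map j.succAbove, stdSimplex.continuous_map _⟩

/-- The singular boundary `d = ∑ (-1)^j d_j`. -/
def singularBoundary (q : ℕ) (X : Type*) [TopologicalSpace X] :
    SChain (q + 1) X →+ SChain q X :=
  Finsupp.liftAddHom fun σ =>
    ∑ j : Fin (q + 2), ((-1 : ℤ) ^ (j : ℕ)) • Finsupp.singleAddHom (σ.comp (faceMap q j))

/-- The chain map induced by a continuous map. -/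
def SChain.push (q : ℕ) (f : C(X, Y)) : SChain q X →+ SChain q Y :=
  Finsupp.mapDomain.addMonoidHom fun σ => f.comp σ

/-- A point as a singular `0`-simplex. -/
def pointSimplex (x : X) : C(stdSimplex ℝ (Fin 1), X) := ContinuousMap.const _ x

/-- A path as a singular `1`-simplex, from the vertex `0` to the vertex `1`. -/
def pathSimplex {x y : X} (γ : Path x y) : C(stdSimplex ℝ (Fin 2), X) :=
  γ.toContinuousMap.comp ⟨stdSimplexHomeomorphUnitInterval, by fun_prop⟩

lemma boundary_path {x y : X} (γ : Path x y) :
    singularBoundary 0 X (Finsupp.single (pathSimplex γ) 1) =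
      Finsupp.single (pointSimplex y) 1 - Finsupp.single (pointSimplex x) 1 := by
  have h (j : Fin 2) (p : stdSimplex ℝ (Fin 1)) :
      stdSimplex.map j.succAbove p = stdSimplex.vertex (S := ℝ) (j.succAbove 0) := by
    rw [← stdSimplex.map_vertex]
    congr 1
    exact Subsingleton.elim _ _
  have h0 : (pathSimplex γ).comp (faceMap 0 0) = pointSimplex y := by
    ext p
    have : stdSimplexHomeomorphUnitInterval (stdSimplex.map (Fin.succAbove (0 : Fin 2)) p) = 1 := by
      rw [h]; exact stdSimplexHomeomorphUnitInterval_one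
    simp [pathSimplex, faceMap, pointSimplex, -Fin.succAbove_zero, this]
  have h1 : (pathSimplex γ).comp (faceMap 0 1) = pointSimplex x := by
    ext p
    have : stdSimplexHomeomorphUnitInterval (stdSimplex.map (Fin.succAbove (1 : Fin 2)) p) = 0 := by
      rw [h]; exact stdSimplexHomeomorphUnitInterval_zero
    simp [pathSimplex, faceMap, pointSimplex, this]
  simp [singularBoundary, Fin.sum_univ_two, h0, h1, sub_eq_add_neg]

end Singular

namespace LieGroupoid

variable {E : Type*} [NormedAddCommGroup E] [NormedSpace ℝ E]
  {M : Type*} [TopologicalSpace M] [ChartedSpace E M]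
  {F : Type*} [NormedAddCommGroup F] [NormedSpace ℝ F]
  {G : Type*} [TopologicalSpace G] [ChartedSpace F G]
  (Γ : LieGroupoid E M F G)

/-- The source map as a continuous map. -/
def sC : C(G, M) := ⟨Γ.s, Γ.submersion_s.contMDiff.continuous⟩

/-- The target map as a continuous map. -/
def tC : C(G, M) := ⟨Γ.t, Γ.submersion_t.contMDiff.continuous⟩

/-- The space of composable pairs of arrows. -/
abbrev Composable : Type _ := {p : G × G // Γ.s p.1 = Γ.t p.2}

/-- The product of composable arrows, as a continuous map. -/
def mulC : C(Γ.Composable, G) := ⟨fun p => Γ.mul p.1.1 p.1.2,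
  continuousOn_iff_continuous_domRestrict.1 Γ.smooth_mul.continuousOn⟩

/-- The total singular chains of degree `1`: `C_0(G) ⊕ C_1(M)`. -/
abbrev Chain1 (_Γ : LieGroupoid E M F G) : Type _ := SChain 0 G × SChain 1 M

/-- The total singular chains of degree `2`: `C_0(G⁽²⁾) ⊕ C_1(G) ⊕ C_2(M)`. -/
abbrev Chain2 : Type _ := SChain 0 Γ.Composable × SChain 1 G × SChain 2 M

/-- The total boundary `δ = (-1)^(q+n) ∂ + (-1)^q d` on `C_q(G⁽ⁿ⁾)` in total degree `1`:
`g ↦ -(t g - s g)` for arrows and `γ ↦ -(γ(1) - γ(0))` for singular paths in `M`. -/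
def boundary1 : Γ.Chain1 →+ SChain 0 M :=
  AddMonoidHom.coprod
    (-(SChain.push 0 Γ.tC - SChain.push 0 Γ.sC))
    (-(singularBoundary 0 M))

/-- The total boundary in degree `2`: `(g, h) ↦ h - g h + g` for composable pairs,
`γ ↦ (t γ - s γ) - (γ(1) - γ(0))` for singular paths in `G`, `Σ ↦ d Σ` for `2`-simplices in `M`. -/
def boundary2 : Γ.Chain2 →+ Γ.Chain1 :=
  AddMonoidHom.coprod
    (AddMonoidHom.prod
      (SChain.push 0 ⟨fun p => p.1.2, by fun_prop⟩ - SChain.push 0 Γ.mulC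
        + SChain.push 0 ⟨fun p => p.1.1, by fun_prop⟩) 0)
    (AddMonoidHom.coprod
      (AddMonoidHom.prod (-(singularBoundary 0 G)) (SChain.push 1 Γ.tC - SChain.push 1 Γ.sC))
      (AddMonoidHom.prod 0 (singularBoundary 1 M)))

/-- The first total singular homology group `H_1(G, ℤ)`. -/
abbrev H1 : Type _ := Γ.boundary1.ker ⧸ (Γ.boundary2.range.addSubgroupOf Γ.boundary1.ker)

variable {Γ} in
/-- The total singular `1`-chain `∑ σ_k + ∑ g_k` of a `G`-path. -/
def GPath.chain {x y : M} : Γ.GPath x y → Γ.Chain1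
  | .path γ _ => (0, Finsupp.single (pathSimplex γ) 1)
  | .snoc σ g _ _ γ _ =>
      GPath.chain σ + (Finsupp.single (pointSimplex g) 1, Finsupp.single (pathSimplex γ) 1)

lemma GPath.boundary_chain {x y : M} (σ : Γ.GPath x y) :
    Γ.boundary1 σ.chain =
      Finsupp.single (pointSimplex x) 1 - Finsupp.single (pointSimplex y) 1 := by
  induction σ with
  | path γ hγ => simp [GPath.chain, boundary1, boundary_path]
  | snoc σ g hs ht γ hγ ih =>
    subst hs ht
    have e₁ : Γ.sC.comp (pointSimplex g) = pointSimplex (Γ.s g) := rfl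
    have e₂ : Γ.tC.comp (pointSimplex g) = pointSimplex (Γ.t g) := rfl
    rw [GPath.chain, map_add, ih]
    simp [boundary1, boundary_path, SChain.push, Finsupp.mapDomain_single, e₁, e₂]

/-- The homology class `|σ| ∈ H_1(G, ℤ)` of a `G`-loop at `x₀`. -/
def loopClass {x₀ : M} (σ : Γ.GPath x₀ x₀) : Γ.H1 :=
  QuotientAddGroup.mk ⟨σ.chain, by simp [AddMonoidHom.mem_ker, GPath.boundary_chain]⟩

section Periods

variable [IsManifold 𝓘(ℝ, E) ∞ M] [FiniteDimensional ℝ E]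

/-- `P` is the `G`-homomorphism of periods of the basic class `ξ`: the homomorphism
`H_1(G, ℤ) → ℝ` through which `σ ↦ ∫_σ η`, for `η` in the class `ξ` and `G`-loops `σ` at `x₀`,
factors. -/
def IsPeriodHom (x₀ : M) (ξ : Γ.BasicH1) (P : Γ.H1 →+ ℝ) : Prop :=
  ∀ η : Γ.closedBasicForms, Γ.basicClass η = ξ →
    ∀ σ : Γ.GPath x₀ x₀, P (Γ.loopClass σ) = σ.integral η.1

/-- The basic class `ξ` is integral: its `G`-homomorphism of periods `H_1(G, ℤ) → ℝ` takes only
integral values. -/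
def IsIntegral (x₀ : M) (ξ : Γ.BasicH1) : Prop :=
  ∃ P : Γ.H1 →+ ℝ, Γ.IsPeriodHom x₀ ξ P ∧ ∀ c : Γ.H1, ∃ k : ℤ, P c = k

end Periods

end LieGroupoid

end LieGpd

end

/-! A circle-valued map `f` lifts locally to an angle, and `f^* dθ` is the differential of that
angle divided by `2π`. Its integral along a path is therefore the total angle change, a quantity
that makes sense for any continuous singular `1`-simplex (`angleChange`). Extended to chains, it
kills boundaries of `2`-simplices, and when `f` is basic it also kills `t γ - s γ` for singular
paths `γ` in `G`; so it descends to `H_1(G, ℤ)` (`periodHom`). On a cycle the exponential of the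
angle change is the product of the values of `f` over the boundary, which cancels because `f ∘ s = f
∘ t`; hence the periods are integers. Replacing `f^* dθ` by a cohomologous form adds `dh` with `h`
basic, whose integral over a `G`-loop telescopes to zero.

Conversely, integral periods over loops make `f(x) = exp(2πi ∫_σ η)` independent of the `G`-path `σ`
from `x₀` to `x`. By the Poincaré lemma `f` is locally `a · exp(2πi h)` with `dh = η`, so it is
smooth with `f^* dθ = η`. It is basic because crossing an arrow costs no integral. This is
`exists_isPullbackAngle`. That integrality of the class gives integral periods over loops is
immediate, `η` being in its own class. -/

noncomputable section

namespace LieGpd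

/-! ### Line integrals and primitives along paths -/

section FTC

/-- The fundamental theorem of calculus for a piecewise `C¹` function. -/
lemma integral_eq_sub_of_piecewise {u g : ℝ → ℝ} {n : ℕ} {τ : ℕ → ℝ} (hτ : Monotone τ)
    (hu : ∀ i < n, τ i < τ (i + 1) → ContDiffOn ℝ 1 u (Icc (τ i) (τ (i + 1))) ∧
      ∀ r ∈ Ioo (τ i) (τ (i + 1)), HasDerivAt u (g r) r) :
    ∫ r in τ 0..τ n, g r = u (τ n) - u (τ 0) := by
  have key : ∀ i < n, IntervalIntegrable g MeasureTheory.volume (τ i) (τ (i + 1)) ∧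
      ∫ r in τ i..τ (i + 1), g r = u (τ (i + 1)) - u (τ i) := by
    intro i hi
    -- The subdivision is only monotone, so intervals may degenerate to a point; these contribute
    -- zero.
    rcases (hτ (Nat.le_succ i)).eq_or_lt with h | h
    · simp only [Nat.succ_eq_add_one] at h
      simp [← h]
    simp only [Nat.succ_eq_add_one] at h
    obtain ⟨hc, hd⟩ := hu i hi h
    have hint : IntervalIntegrable g MeasureTheory.volume (τ i) (τ (i + 1)) := by
      have h1 := hc.continuousOn_derivWithin (uniqueDiffOn_Icc h) le_rfl
      have h2 := (h1.intervalIntegrable_of_Icc (μ := MeasureTheory.volume) h.le)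
      -- `g` is known to be the derivative only on the open interval; the endpoints are a null set.
      refine h2.congr_ae ?_
      rw [uIoc_of_le h.le, ← MeasureTheory.restrict_Ioo_eq_restrict_Ioc]
      refine (MeasureTheory.ae_restrict_iff' measurableSet_Ioo).2 (.of_forall fun r hr => ?_)
      rw [derivWithin_of_mem_nhds (Icc_mem_nhds hr.1 hr.2), (hd r hr).deriv]
    exact ⟨hint, intervalIntegral.integral_eq_sub_of_hasDerivAt_of_le h.le hc.continuousOn hd hint⟩
  rw [← intervalIntegral.sum_integral_adjacent_intervals fun k hk => (key k hk).1,
    Finset.sum_congr rfl fun k hk => (key k (Finset.mem_range.1 hk)).2, Finset.sum_range_sub (fun k => u (τ k))]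

variable {E : Type*} [NormedAddCommGroup E] [NormedSpace ℝ E]
  {M : Type*} [TopologicalSpace M] [ChartedSpace E M] [IsManifold 𝓘(ℝ, E) ∞ M]

/-- The line integral along a piecewise smooth path, computed from a primitive along the path. -/
lemma OneForm.pathIntegral_eq_sub (η : OneForm E M) {x y : M} {γ : Path x y}
    (hγ : IsPiecewiseSmooth E γ) (u : ℝ → ℝ)
    (hu : ∀ a b, 0 ≤ a → a < b → b ≤ 1 →
      ContMDiffOn 𝓘(ℝ, ℝ) 𝓘(ℝ, E) ∞ γ.extend (Icc a b) → ContDiffOn ℝ 1 u (Icc a b) ∧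
      ∀ r ∈ Ioo a b, MDifferentiableAt 𝓘(ℝ, ℝ) 𝓘(ℝ, E) γ.extend r →
        HasDerivAt u (η.at (γ.extend r) (mfderiv 𝓘(ℝ, ℝ) 𝓘(ℝ, E) γ.extend r (1 : ℝ))) r) :
    η.pathIntegral γ = u 1 - u 0 := by
  obtain ⟨n, τ, hτ, h0, h1, hs⟩ := hγ
  have := integral_eq_sub_of_piecewise (u := u) (n := n) (g := fun r => η.at (γ.extend r)
    (mfderiv 𝓘(ℝ, ℝ) 𝓘(ℝ, E) γ.extend r (1 : ℝ))) hτ fun i hi hlt => by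
      obtain ⟨hc, hd⟩ := hu _ _ (h0 ▸ hτ (Nat.zero_le i)) hlt (h1 ▸ hτ hi) (hs i hi)
      exact ⟨hc, fun r hr => hd r hr (((hs i hi).contMDiffAt
        (Icc_mem_nhds hr.1 hr.2)).mdifferentiableAt (by simp))⟩
  rw [h0, h1] at this
  exact this

/-- The line integral of a form with a primitive near the path. -/
lemma OneForm.pathIntegral_eq_sub_of_primitive (η : OneForm E M) {x y : M} {γ : Path x y}
    (hγ : IsPiecewiseSmooth E γ) {U : Set M} (hU : IsOpen U) (hγU : ∀ r, γ r ∈ U) {h : M → ℝ}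
    (hh : ContMDiffOn 𝓘(ℝ, E) 𝓘(ℝ, ℝ) ∞ h U) (hη : ∀ z ∈ U, η.at z = mvfderiv 𝓘(ℝ, E) h z) :
    η.pathIntegral γ = h y - h x := by
  have hmem : ∀ r, γ.extend r ∈ U := fun r => hγU _
  have := η.pathIntegral_eq_sub hγ (h ∘ γ.extend) fun a b _ hab _ hs => by
    refine ⟨?_, fun r hr hd => ?_⟩
    · exact ((hh.comp hs fun r _ => hmem r).contDiffOn).of_le (by simp)
    · have h1 : MDifferentiableAt 𝓘(ℝ, E) 𝓘(ℝ, ℝ) h (γ.extend r) :=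
        (hh.contMDiffAt (hU.mem_nhds (hmem r))).mdifferentiableAt (by simp)
      have h2 : HasFDerivAt (h ∘ γ.extend) ((mfderiv 𝓘(ℝ, E) 𝓘(ℝ, ℝ) h (γ.extend r) : E →L[ℝ] ℝ).comp
          (mfderiv 𝓘(ℝ, ℝ) 𝓘(ℝ, E) γ.extend r : ℝ →L[ℝ] E)) r :=
        (h1.hasMFDerivAt.comp r hd.hasMFDerivAt).hasFDerivAt
      rw [hη _ (hmem r)]
      exact HasFDerivAt.hasDerivAt (𝕜 := ℝ) (F := ℝ) (f := h ∘ γ.extend) h2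
  simpa using this

end FTC

/-! ### The angle form and smooth angle functions -/

section Circle

attribute [local instance] finrank_real_complex_fact'

variable {E : Type*} [NormedAddCommGroup E] [NormedSpace ℝ E]
  {M : Type*} [TopologicalSpace M] [ChartedSpace E M]

/-- Differentiating `a · exp(2πi h)` in `ℂ` gives `2πi f dh`, and the angle form divides out both
`f` and `2πi`. This identifies `f^* dθ` with `dh` wherever `h` is a local angle of `f`. -/
lemma angleForm_mfderiv {f : M → Circle} {h : M → ℝ} {a : Circle} {x : M}
    (hf : f =ᶠ[𝓝 x] fun y => a * Circle.exp (2 * Real.pi * h y))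
    (hh : MDifferentiableAt 𝓘(ℝ, E) 𝓘(ℝ, ℝ) h x) (v : TangentSpace 𝓘(ℝ, E) x) :
    angleForm (f x) (mfderiv 𝓘(ℝ, E) (𝓡 1) f x v) = mvfderiv 𝓘(ℝ, E) h x v := by
  have hE : MDifferentiable 𝓘(ℝ, ℝ) (𝓡 1) fun r : ℝ => a * Circle.exp (2 * Real.pi * r) := by
    have h1 : ContMDiff 𝓘(ℝ, ℝ) (𝓡 1) ∞ fun r : ℝ => Circle.exp (2 * Real.pi * r) :=
      contMDiff_circleExp.comp (contDiff_const.mul contDiff_id).contMDiff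
    exact (contMDiff_const.mul h1).mdifferentiable (by simp)
  have hfd : MDifferentiableAt 𝓘(ℝ, E) (𝓡 1) f x :=
    ((hE (h x)).comp x hh).congr_of_eventuallyEq hf
  have hcoe : MDifferentiableAt (𝓡 1) 𝓘(ℝ, ℂ) (fun w : Circle => (w : ℂ)) (f x) :=
    (contMDiff_coe_sphere (m := ∞)).mdifferentiable (by simp) (f x)
  have hG : HasDerivAt (fun r : ℝ => (a : ℂ) * Complex.exp (2 * Real.pi * r * Complex.I))
      (a * Complex.exp (2 * Real.pi * h x * Complex.I) * (2 * Real.pi * Complex.I)) (h x) := by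
    have h1 : HasDerivAt (fun r : ℝ => (2 * Real.pi * r * Complex.I : ℂ))
        (2 * Real.pi * Complex.I) (h x) := by
      have := ((Complex.ofRealCLM.hasDerivAt (x := h x)).const_mul (2 * Real.pi : ℂ)).mul_const
        Complex.I
      simpa using this
    simpa [mul_assoc] using h1.cexp.const_mul (a : ℂ)
  have e1 : HasMFDerivAt 𝓘(ℝ, E) 𝓘(ℝ, ℂ) ((fun w : Circle => (w : ℂ)) ∘ f) x _ :=
    hcoe.hasMFDerivAt.comp x hfd.hasMFDerivAt
  have e2 : HasMFDerivAt 𝓘(ℝ, E) 𝓘(ℝ, ℂ)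
      ((fun r : ℝ => (a : ℂ) * Complex.exp (2 * Real.pi * r * Complex.I)) ∘ h) x _ :=
    hG.hasFDerivAt.hasMFDerivAt.comp x hh.hasMFDerivAt
  have e3 : (fun w : Circle => (w : ℂ)) ∘ f =ᶠ[𝓝 x]
      (fun r : ℝ => (a : ℂ) * Complex.exp (2 * Real.pi * r * Complex.I)) ∘ h := by
    filter_upwards [hf] with y hy
    simp [hy, Circle.coe_exp]
  have e4 := hasMFDerivAt_unique (e1.congr_of_eventuallyEq e3.symm) e2
  have e5 : mfderiv (𝓡 1) 𝓘(ℝ, ℂ) (fun w : Circle => (w : ℂ)) (f x)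
      (mfderiv 𝓘(ℝ, E) (𝓡 1) f x v) = (mvfderiv 𝓘(ℝ, E) h x v : ℝ) •
      ((a : ℂ) * Complex.exp (2 * Real.pi * h x * Complex.I) * (2 * (Real.pi : ℂ) * Complex.I)) :=
    congrArg (fun L => L v) e4
  have e6 : ((f x : Circle) : ℂ) = a * Complex.exp (2 * Real.pi * h x * Complex.I) := e3.eq_of_nhds
  have e7 : angleForm (f x) (mfderiv 𝓘(ℝ, E) (𝓡 1) f x v) = (2 * Real.pi)⁻¹ *
      (starRingEnd ℂ (f x : ℂ) * show ℂ from (mfderiv (𝓡 1) 𝓘(ℝ, ℂ) (fun w : Circle => (w : ℂ)) (f x)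
      (mfderiv 𝓘(ℝ, E) (𝓡 1) f x v))).im := rfl
  -- Since `f x` has modulus one, its conjugate removes the factor `f x` from the derivative.
  have e8 : starRingEnd ℂ (f x : ℂ) * (f x : ℂ) = 1 := by
    rw [← Complex.normSq_eq_conj_mul_self]; simp
  have e9 (c : ℝ) (w : ℂ) : starRingEnd ℂ (f x : ℂ) * (c • ((f x : ℂ) * w)) = c • w := by
    rw [mul_smul_comm, ← mul_assoc, e8, one_mul]
  rw [e7, e5, ← e6, e9]
  have := Real.pi_ne_zero
  simp
  field_simp

/-- A continuous angle function of a smooth map to the circle is smooth. -/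
lemma contDiffOn_of_circleExp {u : ℝ → ℝ} (hu : Continuous u) {w : ℝ → Circle}
    (hw : ∀ r, Circle.exp (u r) = w r) {s : Set ℝ} {n : ℕ∞ω}
    (hs : ContMDiffOn 𝓘(ℝ, ℝ) (𝓡 1) n w s) : ContDiffOn ℝ n u s := by
  intro r₀ hr₀
  have h1 : ContDiffOn ℝ n (fun r => (w r : ℂ)) s :=
    ((contMDiff_coe_sphere (m := n)).comp_contMDiffOn hs).contDiffOn
  have h2 : ContDiffWithinAt ℝ n (fun r => (w r : ℂ) / (w r₀ : ℂ)) s r₀ :=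
    (h1 r₀ hr₀).div_const _
  have h3 : ContDiffAt ℝ n Complex.log ((w r₀ : ℂ) / (w r₀ : ℂ)) := by
    refine (Complex.contDiffAt_log ?_).restrict_scalars ℝ
    simp
  have h4 : ContDiffWithinAt ℝ n
      (fun r => (Complex.log ((w r : ℂ) / (w r₀ : ℂ))).im + u r₀) s r₀ :=
    (Complex.imCLM.contDiff.contDiffAt.comp_contDiffWithinAt r₀
      (h3.comp_contDiffWithinAt r₀ h2)).add contDiffWithinAt_const
  refine h4.congr_of_eventuallyEq ?_ (by simp)
  refine mem_nhdsWithin_of_mem_nhds ?_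
  -- Within `π` of `u r₀` the quotient `w r / w r₀` has principal argument exactly `u r - u r₀`, so
  -- the logarithm recovers `u`.
  have h5 : ∀ᶠ r in 𝓝 r₀, |u r - u r₀| < Real.pi := by
    have := (hu.sub (continuous_const (y := u r₀))).abs.tendsto r₀ |>.eventually_lt_const
      (u := Real.pi) (by simpa using Real.pi_pos)
    exact this
  filter_upwards [h5] with r hr
  rw [abs_lt] at hr
  have : (w r : ℂ) / (w r₀ : ℂ) = Complex.exp ((u r - u r₀ : ℝ) * Complex.I) := by
    rw [← hw, ← hw, Circle.coe_exp, Circle.coe_exp, ← Complex.exp_sub]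
    congr 1; push_cast; ring
  rw [this, Complex.log_exp (by simpa using hr.1) (by simpa using hr.2.le)]
  simp

end Circle

/-! ### Angle change of singular chains -/

section AngleChange

instance contractibleSpace_stdSimplex (n : ℕ) : ContractibleSpace (stdSimplex ℝ (Fin (n + 1))) :=
  (convex_stdSimplex ℝ _).contractibleSpace ⟨_, single_mem_stdSimplex ℝ 0⟩

/-- Read backwards, a contraction of `A` deforms a constant map into `φ`. The constant lifts through
the covering `Circle.exp`, and the lifted homotopy at time `1` is a lift of `φ`. -/
lemma exists_circleExp_lift {A : Type*} [TopologicalSpace A] [ContractibleSpace A]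
    (φ : C(A, Circle)) : ∃ u : C(A, ℝ), ∀ p, Circle.exp (u p) = φ p := by
  obtain ⟨y, ⟨K⟩⟩ := id_nullhomotopic A
  obtain ⟨e, he⟩ : ∃ e, Circle.exp e = φ y := ⟨_, Circle.exp_arg (φ y)⟩
  have cov := Circle.isCoveringMap_exp
  let H : C(unitInterval × A, Circle) := φ.comp K.symm.toContinuousMap
  have H0 : ∀ a, H (0, a) = Circle.exp ((ContinuousMap.const A e) a) := fun a => by
    simp [H, he]
  refine ⟨(cov.liftHomotopy H (ContinuousMap.const A e) H0).comp
    ((ContinuousMap.const A 1).prodMk (ContinuousMap.id A)), fun p => ?_⟩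
  have := congrFun (cov.liftHomotopy_lifts H (ContinuousMap.const A e) H0) (1, p)
  simpa [H] using this

/-- The change `θ(φ(1)) - θ(φ(0))` of the angle along a singular `1`-simplex of the circle. -/
def angleChange (φ : C(stdSimplex ℝ (Fin 2), Circle)) : ℝ :=
  (2 * Real.pi)⁻¹ * ((exists_circleExp_lift φ).choose (stdSimplex.vertex 1) -
    (exists_circleExp_lift φ).choose (stdSimplex.vertex 0))

/-- Two lifts over the connected simplex differ by a constant, by uniqueness of lifts, so any lift
computes the angle change. -/
lemma angleChange_eq {φ : C(stdSimplex ℝ (Fin 2), Circle)} (u : C(stdSimplex ℝ (Fin 2), ℝ))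
    (hu : ∀ p, Circle.exp (u p) = φ p) :
    angleChange φ = (2 * Real.pi)⁻¹ * (u (stdSimplex.vertex 1) - u (stdSimplex.vertex 0)) := by
  set w := (exists_circleExp_lift φ).choose with hw
  have hw' : ∀ p, Circle.exp (w p) = φ p := (exists_circleExp_lift φ).choose_spec
  set p₀ : stdSimplex ℝ (Fin 2) := stdSimplex.vertex 0
  have h1 : Circle.exp (w p₀ - u p₀) = 1 := by simp [Circle.exp_sub, hu, hw']
  have h2 : (fun p => u p + (w p₀ - u p₀)) = w := by
    refine Circle.isCoveringMap_exp.eq_of_comp_eq (by fun_prop) w.continuous ?_ p₀ (by ring)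
    ext p
    simp [Circle.exp_add, h1, hu, hw', -Circle.exp_sub]
  have h3 := congrFun h2 (stdSimplex.vertex 1)
  have h4 := congrFun h2 p₀
  rw [angleChange, ← hw, ← h3, ← h4]
  ring

lemma circleExp_angleChange (φ : C(stdSimplex ℝ (Fin 2), Circle)) :
    Circle.exp (2 * Real.pi * angleChange φ) =
      φ (stdSimplex.vertex 1) * (φ (stdSimplex.vertex 0))⁻¹ := by
  have hw := (exists_circleExp_lift φ).choose_spec
  rw [← hw, ← hw, angleChange, ← mul_assoc, mul_inv_cancel₀ (by positivity), one_mul,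
    Circle.exp_sub, div_eq_mul_inv]

lemma faceMap_vertex (q : ℕ) (j : Fin (q + 2)) (i : Fin (q + 1)) :
    faceMap q j (stdSimplex.vertex i) = stdSimplex.vertex (j.succAbove i) :=
  stdSimplex.map_vertex _ _

variable {X Y : Type*} [TopologicalSpace X] [TopologicalSpace Y]

/-- The total angle change of a singular `1`-chain under a circle-valued map. -/
def chainAngle (f : C(X, Circle)) : SChain 1 X →+ ℝ :=
  Finsupp.liftAddHom fun σ => zmultiplesHom ℝ (angleChange (f.comp σ))

lemma chainAngle_single (f : C(X, Circle)) (σ : C(stdSimplex ℝ (Fin 2), X)) (k : ℤ) :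
    chainAngle f (Finsupp.single σ k) = k • angleChange (f.comp σ) := by
  simp [chainAngle]

lemma chainAngle_push (f : C(Y, Circle)) (g : C(X, Y)) (c : SChain 1 X) :
    chainAngle f (SChain.push 1 g c) = chainAngle (f.comp g) c := by
  refine DFunLike.congr_fun (f := (chainAngle f).comp (SChain.push 1 g)) ?_ c
  ext σ
  simp [SChain.push, Finsupp.mapDomain_single, chainAngle_single, ContinuousMap.comp_assoc]

/-- A single lift over the whole `2`-simplex restricts to lifts over its faces, and the differences
of vertex values cancel around the boundary. -/
lemma chainAngle_boundary (f : C(X, Circle)) (c : SChain 2 X) :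
    chainAngle f (singularBoundary 1 X c) = 0 := by
  refine DFunLike.congr_fun (f := (chainAngle f).comp (singularBoundary 1 X)) (g := 0) ?_ c
  ext σ
  obtain ⟨u, hu⟩ := exists_circleExp_lift (f.comp σ)
  have h (j : Fin 3) : angleChange (f.comp (σ.comp (faceMap 1 j))) =
      (2 * Real.pi)⁻¹ * (u (stdSimplex.vertex (j.succAbove 1)) -
        u (stdSimplex.vertex (j.succAbove 0))) := by
    rw [angleChange_eq (u.comp (faceMap 1 j)) (fun p => hu _)]
    simp [faceMap_vertex]
  simp [singularBoundary, Fin.sum_univ_three, chainAngle_single, h, -Fin.succAbove_zero]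
  have e : (2 : Fin 3).succAbove 1 = 1 := rfl
  rw [e]
  ring

/-- The product of the values of a circle-valued map over a singular `0`-chain. -/
def chainValue (f : C(X, Circle)) : SChain 0 X →+ Additive Circle :=
  Finsupp.liftAddHom fun σ =>
    zmultiplesHom (Additive Circle) (Additive.ofMul (f (σ (stdSimplex.vertex 0))))

lemma chainValue_single (f : C(X, Circle)) (σ : C(stdSimplex ℝ (Fin 1), X)) (k : ℤ) :
    chainValue f (Finsupp.single σ k) = k • Additive.ofMul (f (σ (stdSimplex.vertex 0))) := by
  simp [chainValue]

lemma chainValue_push (f : C(Y, Circle)) (g : C(X, Y)) (c : SChain 0 X) :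
    chainValue f (SChain.push 0 g c) = chainValue (f.comp g) c := by
  refine DFunLike.congr_fun (f := (chainValue f).comp (SChain.push 0 g)) ?_ c
  ext σ
  simp [SChain.push, Finsupp.mapDomain_single, chainValue]

/-- Both sides are additive in the chain, and on one simplex each is the end value over the initial
value. This turns integrality of an angle change into a statement about the boundary. -/
lemma circleExp_chainAngle (f : C(X, Circle)) (c : SChain 1 X) :
    Additive.ofMul (Circle.exp (2 * Real.pi * chainAngle f c)) =
      chainValue f (singularBoundary 0 X c) := by
  refine DFunLike.congr_fun (f := (Circle.expHom.comp (AddMonoidHom.mulLeft (2 * Real.pi))).comp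
    (chainAngle f)) (g := (chainValue f).comp (singularBoundary 0 X)) ?_ c
  refine Finsupp.addHom_ext' fun σ => AddMonoidHom.ext_int ?_
  have h : Circle.exp (2 * Real.pi * angleChange (f.comp σ)) =
      f (σ (stdSimplex.vertex 1)) * (f (σ (stdSimplex.vertex 0)))⁻¹ := circleExp_angleChange _
  have e0 : faceMap 0 0 (stdSimplex.vertex 0) = stdSimplex.vertex 1 := faceMap_vertex 0 0 0
  have e1 : faceMap 0 1 (stdSimplex.vertex 0) = stdSimplex.vertex 0 := faceMap_vertex 0 1 0
  simp [singularBoundary, Fin.sum_univ_two, chainAngle_single, chainValue_single, Circle.expHom,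
    e0, e1]
  exact congrArg Additive.ofMul h

end AngleChange

/-! ### The period homomorphism of a basic circle-valued map -/

namespace LieGroupoid

variable {E : Type*} [NormedAddCommGroup E] [NormedSpace ℝ E]
  {M : Type*} [TopologicalSpace M] [ChartedSpace E M]
  {F : Type*} [NormedAddCommGroup F] [NormedSpace ℝ F]
  {G : Type*} [TopologicalSpace G] [ChartedSpace F G]
  (Γ : LieGroupoid E M F G)

/-- The homomorphism `H_1(G, ℤ) → ℝ` induced by a basic map to the circle. -/
def periodHom (f : C(M, Circle)) (hf : Γ.IsBasicMap f) : Γ.H1 →+ ℝ :=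
  QuotientAddGroup.lift _
    (((chainAngle f).comp (AddMonoidHom.snd _ _)).comp Γ.boundary1.ker.subtype) <| by
    rintro ⟨_, hc⟩ ⟨⟨p, a, b⟩, rfl⟩
    have hst : f.comp Γ.tC = f.comp Γ.sC := by ext g; exact congrArg _ (hf g).symm
    simp [boundary2, chainAngle_push, chainAngle_boundary, hst]

lemma periodHom_integral (f : C(M, Circle)) (hf : Γ.IsBasicMap f) (c : Γ.H1) :
    ∃ k : ℤ, Γ.periodHom f hf c = k := by
  obtain ⟨⟨⟨a, b⟩, hc⟩, rfl⟩ := QuotientAddGroup.mk_surjective c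
  change ∃ k : ℤ, chainAngle f b = k
  have hst : f.comp Γ.tC = f.comp Γ.sC := by ext g; exact congrArg _ (hf g).symm
  have h1 : singularBoundary 0 M b = -(SChain.push 0 Γ.tC a - SChain.push 0 Γ.sC a) := by
    have : Γ.boundary1 (a, b) = 0 := hc
    simp only [boundary1, AddMonoidHom.coprod_apply, AddMonoidHom.neg_apply,
      AddMonoidHom.sub_apply] at this
    exact (add_neg_eq_zero.1 this).symm
  have h2 := circleExp_chainAngle f b
  -- The boundary of `b` is carried by sources and targets of the arrows in `a`, where `f` takes
  -- equal values.
  rw [h1, map_neg, map_sub, chainValue_push, chainValue_push, hst, sub_self, neg_zero] at h2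
  have h3 : Circle.exp (2 * Real.pi * chainAngle f b) = 1 := h2
  obtain ⟨k, hk⟩ := Circle.exp_eq_one.1 h3
  refine ⟨k, ?_⟩
  have := Real.pi_pos
  have : 2 * Real.pi * chainAngle f b = 2 * Real.pi * k := by rw [hk]; ring
  exact mul_left_cancel₀ (by positivity) this

end LieGroupoid

/-! ### Line integrals of pullbacks of the angle form -/

section Pullback

attribute [local instance] finrank_real_complex_fact'

variable {E : Type*} [NormedAddCommGroup E] [NormedSpace ℝ E]
  {M : Type*} [TopologicalSpace M] [ChartedSpace E M] [IsManifold 𝓘(ℝ, E) ∞ M]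

/-- The line integral of `f^* dθ + dh` along a piecewise smooth path. -/
lemma OneForm.pathIntegral_eq_angleChange {η η' : OneForm E M} {f : C(M, Circle)}
    (hf : ContMDiff 𝓘(ℝ, E) (𝓡 1) ∞ f) (hη : IsPullbackAngle η f) {h : M → ℝ}
    (hh : ContMDiff 𝓘(ℝ, E) 𝓘(ℝ, ℝ) ∞ h)
    (hη' : ∀ x, η'.at x = η.at x + mvfderiv 𝓘(ℝ, E) h x)
    {x y : M} {γ : Path x y} (hγ : IsPiecewiseSmooth E γ) :
    η'.pathIntegral γ = angleChange (f.comp (pathSimplex γ)) + (h y - h x) := by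
  obtain ⟨w, hw⟩ := exists_circleExp_lift (f.comp (pathSimplex γ))
  let e := stdSimplexHomeomorphUnitInterval
  let u : ℝ → ℝ := fun r => w (e.symm (projIcc 0 1 zero_le_one r))
  have hu : Continuous u := by fun_prop
  have hexp : ∀ r, Circle.exp (u r) = (f ∘ γ.extend) r := fun r => by
    rw [hw]
    simp [pathSimplex, e, Path.extend, IccExtend]
  have hpi := Real.pi_pos
  -- The primitive is the lifted angle over `2π` plus `h`; the angle is a function along the path
  -- only, not on `M`.
  have key := η'.pathIntegral_eq_sub hγ ((fun r => (2 * Real.pi)⁻¹ * u r) + h ∘ γ.extend)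
    fun a b _ hab _ hs => by
      have hfs : ContMDiffOn 𝓘(ℝ, ℝ) (𝓡 1) ∞ (f ∘ γ.extend) (Icc a b) := hf.comp_contMDiffOn hs
      have hus : ContDiffOn ℝ ∞ u (Icc a b) := contDiffOn_of_circleExp hu hexp hfs
      have hhs : ContDiffOn ℝ ∞ (h ∘ γ.extend) (Icc a b) := (hh.comp_contMDiffOn hs).contDiffOn
      refine ⟨((contDiffOn_const.mul hus).add hhs).of_le (by simp), fun r hr hd => ?_⟩
      have hur : DifferentiableAt ℝ (fun r => (2 * Real.pi)⁻¹ * u r) r :=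
        ((hus.contDiffAt (Icc_mem_nhds hr.1 hr.2)).differentiableAt (by simp)).const_mul _
      have h1 : MDifferentiableAt 𝓘(ℝ, E) 𝓘(ℝ, ℝ) h (γ.extend r) :=
        hh.mdifferentiableAt (by simp)
      have h2 : HasFDerivAt (h ∘ γ.extend)
          ((mfderiv 𝓘(ℝ, E) 𝓘(ℝ, ℝ) h (γ.extend r) : E →L[ℝ] ℝ).comp
          (mfderiv 𝓘(ℝ, ℝ) 𝓘(ℝ, E) γ.extend r : ℝ →L[ℝ] E)) r :=
        (h1.hasMFDerivAt.comp r hd.hasMFDerivAt).hasFDerivAt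
      have h3 : HasDerivAt (h ∘ γ.extend) (mvfderiv 𝓘(ℝ, E) h (γ.extend r)
          (mfderiv 𝓘(ℝ, ℝ) 𝓘(ℝ, E) γ.extend r (1 : ℝ))) r :=
        HasFDerivAt.hasDerivAt (𝕜 := ℝ) (F := ℝ) (f := h ∘ γ.extend) h2
      have h4 := angleForm_mfderiv (E := ℝ) (M := ℝ) (f := f ∘ γ.extend) (a := 1) (x := r)
        (h := fun r => (2 * Real.pi)⁻¹ * u r) (.of_forall fun r => by
          beta_reduce
          rw [← mul_assoc, mul_inv_cancel₀ (by positivity), one_mul, one_mul, hexp])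
        hur.mdifferentiableAt (1 : ℝ)
      have h5 : mfderiv 𝓘(ℝ, ℝ) (𝓡 1) (f ∘ γ.extend) r =
          (mfderiv 𝓘(ℝ, E) (𝓡 1) f (γ.extend r)).comp (mfderiv 𝓘(ℝ, ℝ) 𝓘(ℝ, E) γ.extend r) :=
        mfderiv_comp r (hf.mdifferentiableAt (by simp)) hd
      have h6 : mvfderiv 𝓘(ℝ, ℝ) (fun r => (2 * Real.pi)⁻¹ * u r) r (1 : ℝ) =
          deriv (fun r => (2 * Real.pi)⁻¹ * u r) r := by
        rw [← fderiv_apply_one_eq_deriv, ← mfderiv_eq_fderiv]; rfl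
      rw [hη', add_apply, hη]
      refine HasDerivAt.add ?_ h3
      rw [h6, h5] at h4
      exact h4 ▸ hur.hasDerivAt
  have hv0 : e.symm 0 = stdSimplex.vertex 0 := e.symm_apply_eq.2 rfl
  have hv1 : e.symm 1 = stdSimplex.vertex 1 := e.symm_apply_eq.2 rfl
  rw [key, angleChange_eq w hw, ← hv0, ← hv1]
  simp [u]
  ring

end Pullback

/-! ### Periods over `G`-paths -/

namespace LieGroupoid

variable {E : Type*} [NormedAddCommGroup E] [NormedSpace ℝ E]
  {M : Type*} [TopologicalSpace M] [ChartedSpace E M] [IsManifold 𝓘(ℝ, E) ∞ M]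
  {F : Type*} [NormedAddCommGroup F] [NormedSpace ℝ F]
  {G : Type*} [TopologicalSpace G] [ChartedSpace F G]
  {Γ : LieGroupoid E M F G}

/-- The increments of `h` telescope: `h` agrees at both ends of each arrow. On a loop the `h` term
vanishes, so all forms in a basic class share the same periods. -/
lemma GPath.integral_eq_chainAngle {η η' : OneForm E M} {f : C(M, Circle)}
    (hf : ContMDiff 𝓘(ℝ, E) (𝓡 1) ∞ f) (hη : IsPullbackAngle η f) {h : M → ℝ}
    (hh : ContMDiff 𝓘(ℝ, E) 𝓘(ℝ, ℝ) ∞ h) (hbas : Γ.IsBasicMap h)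
    (hη' : ∀ x, η'.at x = η.at x + mvfderiv 𝓘(ℝ, E) h x) {x y : M} (σ : Γ.GPath x y) :
    σ.integral η' = chainAngle f σ.chain.2 + (h y - h x) := by
  induction σ with
  | path γ hγ =>
    simp [GPath.integral, GPath.chain, chainAngle_single,
      OneForm.pathIntegral_eq_angleChange hf hη hh hη' hγ]
  | snoc σ g hs ht γ hγ ih =>
    have := hbas g
    subst hs ht
    simp [GPath.integral, GPath.chain, chainAngle_single, ih,
      OneForm.pathIntegral_eq_angleChange hf hη hh hη' hγ]
    linarith

lemma isIntegral_of_isPullbackAngle [FiniteDimensional ℝ E] (x₀ : M) {η : Γ.closedBasicForms}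
    {f : M → Circle} (hf : ContMDiff 𝓘(ℝ, E) (𝓡 1) ∞ f) (hbas : Γ.IsBasicMap f)
    (hη : IsPullbackAngle η.1 f) : Γ.IsIntegral x₀ (Γ.basicClass η) := by
  let f' : C(M, Circle) := ⟨f, hf.continuous⟩
  refine ⟨Γ.periodHom f' hbas, fun η' hη' σ => ?_, Γ.periodHom_integral f' hbas⟩
  obtain ⟨h, hh, hb, hd⟩ := (Submodule.Quotient.eq _).1 hη'
  have h1 : ∀ x, η'.1.at x = η.1.at x + mvfderiv 𝓘(ℝ, E) h x := fun x => by
    rw [← hd x]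
    exact (add_sub_cancel (η.1.at x) (η'.1.at x)).symm
  rw [GPath.integral_eq_chainAngle (f := f') hf hη hh hb h1]
  simp [periodHom, loopClass]

/-- Concatenation of `G`-paths, with a unit arrow in between. -/
def GPath.append {x y z : M} (σ : Γ.GPath x y) : Γ.GPath y z → Γ.GPath x z
  | .path γ hγ => .snoc σ (Γ.unit y) (Γ.s_unit y) (Γ.t_unit y) γ hγ
  | .snoc τ g hs ht γ hγ => .snoc (GPath.append σ τ) g hs ht γ hγ

lemma GPath.integral_append (η : OneForm E M) {x y z : M} (σ : Γ.GPath x y) (τ : Γ.GPath y z) :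
    (σ.append τ).integral η = σ.integral η + τ.integral η := by
  induction τ with
  | path γ hγ => simp [GPath.append, GPath.integral]
  | snoc τ g hs ht γ hγ ih => simp [GPath.append, GPath.integral, ih, add_assoc]

end LieGroupoid

/-! ### The Poincaré lemma in a chart -/

section Poincare

variable {E : Type*} [NormedAddCommGroup E] [NormedSpace ℝ E] [FiniteDimensional ℝ E]
  {M : Type*} [TopologicalSpace M] [ChartedSpace E M] [IsManifold 𝓘(ℝ, E) ∞ M]

/-- As `E` is finite-dimensional, smoothness can be tested on fixed vectors `v`, where the
expression pairs the smooth section `η` with the image of `v` under the differential of the inverse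
chart. -/
lemma OneForm.contDiffOn_inChart (η : OneForm E M) (c : M) :
    ContDiffOn ℝ ∞ (η.inChart c) (extChartAt 𝓘(ℝ, E) c).target := by
  have ho : IsOpen (extChartAt 𝓘(ℝ, E) c).target := isOpen_extChartAt_target c
  have hφ : ContMDiffOn 𝓘(ℝ, E) 𝓘(ℝ, E) ∞ (extChartAt 𝓘(ℝ, E) c).symm
      (extChartAt 𝓘(ℝ, E) c).target := contMDiffOn_extChartAt_symm c
  rw [contDiffOn_clm_apply]
  intro v z hz
  have hv : ContMDiffAt 𝓘(ℝ, E) (𝓘(ℝ, E).prod 𝓘(ℝ, E)) ∞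
      (fun y : E => (Bundle.TotalSpace.mk' E y v : TangentBundle 𝓘(ℝ, E) E)) z := by
    rw [Bundle.contMDiffAt_totalSpace]
    exact ⟨contMDiffAt_id, by simpa using! contMDiffAt_const⟩
  have hT := (hφ.contMDiffOn_tangentMapWithin (m := ∞) (by simp) ho.uniqueMDiffOn)
  have h1 : ContMDiffAt 𝓘(ℝ, E) (𝓘(ℝ, E).prod 𝓘(ℝ, E)) ∞
      (fun y : E => (Bundle.TotalSpace.mk' E ((extChartAt 𝓘(ℝ, E) c).symm y)
        (mfderiv 𝓘(ℝ, E) 𝓘(ℝ, E) (extChartAt 𝓘(ℝ, E) c).symm y v) :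
          TangentBundle 𝓘(ℝ, E) M)) z := by
    have h2 := (hT.contMDiffAt (x := (⟨z, v⟩ : TangentBundle 𝓘(ℝ, E) E))
      ((ho.preimage (FiberBundle.continuous_proj E _)).mem_nhds hz)).comp z hv
    refine h2.congr_of_eventuallyEq ?_
    filter_upwards [ho.mem_nhds hz] with y hy
    change Bundle.TotalSpace.mk' E _ _ = Bundle.TotalSpace.mk' E _ _
    rw [← mfderivWithin_of_isOpen ho hy]
  have h3 : ContMDiffAt 𝓘(ℝ, E) (𝓘(ℝ, E).prod 𝓘(ℝ, E →L[ℝ] ℝ)) ∞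
      (fun y : E => Bundle.TotalSpace.mk' (E →L[ℝ] ℝ)
        (E := fun x : M => TangentSpace 𝓘(ℝ, E) x →L[ℝ] Bundle.Trivial M ℝ x)
        ((extChartAt 𝓘(ℝ, E) c).symm y) (η ((extChartAt 𝓘(ℝ, E) c).symm y))) z :=
    (η.contMDiff _).comp z (hφ.contMDiffAt (ho.mem_nhds hz))
  have h4 := h3.clm_bundle_apply h1
  rw [Bundle.contMDiffAt_totalSpace] at h4
  exact (h4.2.contDiffAt).contDiffWithinAt

/-- The Poincaré lemma: a closed `1`-form has a primitive near each point. -/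
lemma OneForm.IsClosed.exists_local_primitive {η : OneForm E M} (hη : η.IsClosed) (c : M) :
    ∃ U : Set M, IsOpen U ∧ c ∈ U ∧ ∃ h : M → ℝ, ContMDiffOn 𝓘(ℝ, E) 𝓘(ℝ, ℝ) ∞ h U ∧
      (∀ z ∈ U, η.at z = mvfderiv 𝓘(ℝ, E) h z) ∧
      ∀ x ∈ U, ∃ γ : Path c x, IsPiecewiseSmooth E γ ∧ ∀ r, γ r ∈ U := by
  set φ := extChartAt 𝓘(ℝ, E) c with hφ
  obtain ⟨ε, hε, hB⟩ := Metric.isOpen_iff.1 (isOpen_extChartAt_target (I := 𝓘(ℝ, E)) c) (φ c)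
    (mem_extChartAt_target c)
  set B := Metric.ball (φ c) ε
  have hBc : Convex ℝ B := convex_ball _ _
  have hcB : φ c ∈ B := Metric.mem_ball_self hε
  have hsm := (η.contDiffOn_inChart c).mono hB
  obtain ⟨f, hf⟩ := hBc.exists_forall_hasFDerivAt_of_fderiv_symmetric Metric.isOpen_ball
    (hsm.differentiableOn (by simp)) fun a ha x y => hη c a (hB ha) x y
  have hfs : ContDiffOn ℝ ∞ f B := by
    rw [contDiffOn_infty_iff_fderiv_of_isOpen Metric.isOpen_ball]
    exact ⟨fun a ha => (hf a ha).differentiableAt.differentiableWithinAt,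
      hsm.congr fun a ha => (hf a ha).fderiv⟩
  have hsymm : ContMDiffOn 𝓘(ℝ, E) 𝓘(ℝ, E) ∞ φ.symm B := (contMDiffOn_extChartAt_symm c).mono hB
  have hinv : ∀ w ∈ B, φ.symm w ∈ φ.source ∩ φ ⁻¹' B := fun w hw =>
    ⟨φ.map_target (hB hw), by rwa [mem_preimage, φ.right_inv (hB hw)]⟩
  refine ⟨φ.source ∩ φ ⁻¹' B, (continuousOn_extChartAt c).isOpen_inter_preimage
    (isOpen_extChartAt_source c) Metric.isOpen_ball, ⟨mem_extChartAt_source c, hcB⟩, f ∘ φ, ?_, ?_, ?_⟩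
  · refine hfs.contMDiffOn.comp (contMDiffOn_extChartAt.mono ?_) fun z hz => hz.2
    rw [hφ, extChartAt_source]
    exact inter_subset_left
  · rintro z ⟨hz, hzB⟩
    obtain ⟨w, hw, rfl⟩ : ∃ w ∈ B, φ.symm w = z := ⟨φ z, hzB, φ.left_inv hz⟩
    have hr := φ.right_inv (hB hw)
    have h1 : MDifferentiableAt 𝓘(ℝ, E) 𝓘(ℝ, E) φ (φ.symm w) :=
      mdifferentiableAt_extChartAt (by rwa [hφ, extChartAt_source] at hz)
    have h2 : HasMFDerivAt 𝓘(ℝ, E) 𝓘(ℝ, ℝ) f (φ (φ.symm w)) (η.inChart c w) := by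
      rw [hr]; exact (hf w hw).hasMFDerivAt
    have h3 := (h2.comp _ h1.hasMFDerivAt).mfderiv
    -- The differentials of the chart and its inverse cancel, so pulling the coordinate form back by
    -- `φ` returns `η`.
    have h4 : (mfderiv 𝓘(ℝ, E) 𝓘(ℝ, E) φ.symm w).comp (mfderiv 𝓘(ℝ, E) 𝓘(ℝ, E) φ (φ.symm w)) =
        ContinuousLinearMap.id ℝ (TangentSpace 𝓘(ℝ, E) (φ.symm w)) := by
      have := mfderivWithin_extChartAt_symm_comp_mfderiv_extChartAt (I := 𝓘(ℝ, E)) (hB hw)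
      rwa [modelWithCornersSelf_coe, range_id, mfderivWithin_univ] at this
    ext v
    have h5 : mvfderiv 𝓘(ℝ, E) (f ∘ φ) (φ.symm w) v = η.at (φ.symm w)
      (mfderiv 𝓘(ℝ, E) 𝓘(ℝ, E) φ.symm w (mfderiv 𝓘(ℝ, E) 𝓘(ℝ, E) φ (φ.symm w) v)) :=
      congrArg (fun L => L v) h3
    rw [h5]
    exact congrArg (η.at (φ.symm w)) (congrArg (fun L => L v) h4).symm
  · rintro x ⟨hx, hxB⟩
    -- The connecting path is a straight segment in the convex ball, transported by the chart.
    let l : ℝ → E := fun r => AffineMap.lineMap (φ c) (φ x) r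
    have hl : ∀ r ∈ Icc (0 : ℝ) 1, l r ∈ B := fun r hr => hBc.lineMap_mem hcB hxB hr
    have hls : ContDiff ℝ ∞ l := by
      simp only [l, AffineMap.lineMap_apply_module]
      fun_prop
    let γ : Path c x :=
      { toFun := fun r => φ.symm (l r)
        continuous_toFun := hsymm.continuousOn.comp_continuous
          (hls.continuous.comp continuous_subtype_val) fun r => hl r r.2
        source' := by simp [l, hφ]
        target' := by simp [l, φ.left_inv hx] }
    refine ⟨γ, ⟨1, fun i => i, Nat.mono_cast, by simp, by simp, fun i hi => ?_⟩,
      fun r => hinv _ (hl r r.2)⟩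
    obtain rfl : i = 0 := by omega
    have hI : Icc ((0 : ℕ) : ℝ) ((0 + 1 : ℕ) : ℝ) = Icc 0 1 := by simp
    rw [hI]
    refine (hsymm.comp hls.contMDiff.contMDiffOn hl).congr fun r hr => ?_
    simp [Path.extend_apply _ hr, γ]

end Poincare

/-! ### From integral periods to a circle-valued map -/

lemma isPiecewiseSmooth_refl {E : Type*} [NormedAddCommGroup E] [NormedSpace ℝ E]
    {M : Type*} [TopologicalSpace M] [ChartedSpace E M] (x : M) :
    IsPiecewiseSmooth E (Path.refl x) :=
  ⟨1, fun i => i, Nat.mono_cast, by simp, by simp, fun i _ => by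
    have : (Path.refl x).extend = fun _ : ℝ => x := by ext; simp
    exact contMDiffOn_const.congr fun r _ => congrFun this r⟩

lemma OneForm.pathIntegral_refl {E : Type*} [NormedAddCommGroup E] [NormedSpace ℝ E]
    {M : Type*} [TopologicalSpace M] [ChartedSpace E M] [IsManifold 𝓘(ℝ, E) ∞ M]
    (η : OneForm E M) (x : M) : η.pathIntegral (Path.refl x) = 0 := by
  rw [η.pathIntegral_eq_sub (isPiecewiseSmooth_refl x) (fun _ => 0), sub_self]
  intro a b _ _ _ _
  refine ⟨contDiffOn_const, fun r _ _ => ?_⟩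
  have h : ((Path.refl x).extend : ℝ → M) = fun _ : ℝ => x := by ext; simp
  rw [h, mfderiv_const]
  exact (hasDerivAt_const r (0 : ℝ)).congr_deriv (map_zero (η.at x)).symm

namespace LieGroupoid

variable {E : Type*} [NormedAddCommGroup E] [NormedSpace ℝ E]
  {M : Type*} [TopologicalSpace M] [ChartedSpace E M] [IsManifold 𝓘(ℝ, E) ∞ M]
  {F : Type*} [NormedAddCommGroup F] [NormedSpace ℝ F]
  {G : Type*} [TopologicalSpace G] [ChartedSpace F G]
  {Γ : LieGroupoid E M F G}

/-- Closing `σ` and `τ` with a common return path `ρ` gives two loops with integral periods, and the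
integral over `ρ` cancels in their difference. -/
lemma GPath.exp_integral_eq (hΓ : Γ.GConnected) {x₀ : M} {η : OneForm E M}
    (hint : ∀ σ : Γ.GPath x₀ x₀, ∃ k : ℤ, σ.integral η = k) {y : M} (σ τ : Γ.GPath x₀ y) :
    Circle.exp (2 * Real.pi * σ.integral η) = Circle.exp (2 * Real.pi * τ.integral η) := by
  obtain ⟨ρ⟩ := hΓ y x₀
  obtain ⟨k, hk⟩ := hint (σ.append ρ)
  obtain ⟨l, hl⟩ := hint (τ.append ρ)
  rw [GPath.integral_append] at hk hl
  rw [← div_eq_one, ← Circle.exp_sub, Circle.exp_eq_one]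
  refine ⟨k - l, ?_⟩
  push_cast
  rw [← hk, ← hl]
  ring

lemma exists_isPullbackAngle [FiniteDimensional ℝ E] (hΓ : Γ.GConnected) (x₀ : M)
    (η : Γ.closedBasicForms) (hint : ∀ σ : Γ.GPath x₀ x₀, ∃ k : ℤ, σ.integral η.1 = k) :
    ∃ f : M → Circle, ContMDiff 𝓘(ℝ, E) (𝓡 1) ∞ f ∧ Γ.IsBasicMap f ∧ IsPullbackAngle η.1 f := by
  obtain ⟨η, hclosed, hbasic⟩ := η
  replace hint : ∀ σ : Γ.GPath x₀ x₀, ∃ k : ℤ, σ.integral η = k := hint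
  let p (x : M) : Γ.GPath x₀ x := (hΓ x₀ x).some
  let f (x : M) : Circle := Circle.exp (2 * Real.pi * (p x).integral η)
  have hf {x : M} (σ : Γ.GPath x₀ x) : f x = Circle.exp (2 * Real.pi * σ.integral η) :=
    GPath.exp_integral_eq hΓ hint (p x) σ
  have hloc (c : M) : ∃ U : Set M, IsOpen U ∧ c ∈ U ∧ ∃ (h : M → ℝ) (a : Circle),
      ContMDiffOn 𝓘(ℝ, E) 𝓘(ℝ, ℝ) ∞ h U ∧ (∀ z ∈ U, η.at z = mvfderiv 𝓘(ℝ, E) h z) ∧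
      ∀ z ∈ U, f z = a * Circle.exp (2 * Real.pi * h z) := by
    obtain ⟨U, hU, hcU, h, hh, hη, hpath⟩ := hclosed.exists_local_primitive c
    -- The constant is forced by the value at `c`. Prolonging a `G`-path to `c` by a unit arrow and
    -- a path inside `U` adds `h z - h c` to the integral.
    refine ⟨U, hU, hcU, h, f c * Circle.exp (-(2 * Real.pi * h c)), hh, hη, fun z hz => ?_⟩
    obtain ⟨γ, hγ, hγU⟩ := hpath z hz
    rw [hf (.snoc (p c) (Γ.unit c) (Γ.s_unit c) (Γ.t_unit c) γ hγ), GPath.integral,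
      η.pathIntegral_eq_sub_of_primitive hγ hU hγU hh hη, ← Circle.exp_add, ← Circle.exp_add]
    congr 1
    ring
  refine ⟨f, fun c => ?_, fun g => ?_, fun c => ?_⟩
  · obtain ⟨U, hU, hcU, h, a, hh, -, hfa⟩ := hloc c
    have h1 : ContMDiffOn 𝓘(ℝ, E) 𝓘(ℝ, ℝ) ∞ (fun z => 2 * Real.pi * h z) U :=
      (contDiff_const.mul contDiff_id).contMDiff.comp_contMDiffOn hh
    have h2 : ContMDiffOn 𝓘(ℝ, E) (𝓡 1) ∞ (fun z => a * Circle.exp (2 * Real.pi * h z)) U :=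
      contMDiffOn_const.mul (contMDiff_circleExp.comp_contMDiffOn h1)
    exact (h2.congr hfa).contMDiffAt (hU.mem_nhds hcU)
  -- Following `g` and then a constant path reaches `t g` from `s g` without changing the integral.
  · rw [hf (.snoc (p (Γ.s g)) g rfl rfl (Path.refl _) (isPiecewiseSmooth_refl _)), GPath.integral,
      OneForm.pathIntegral_refl, add_zero]
  · obtain ⟨U, hU, hcU, h, a, hh, hη, hfa⟩ := hloc c
    ext v
    rw [hη c hcU]
    exact (angleForm_mfderiv (Filter.eventuallyEq_of_mem (hU.mem_nhds hcU) hfa)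
      ((hh.contMDiffAt (hU.mem_nhds hcU)).mdifferentiableAt (by simp)) v).symm

end LieGroupoid

end LieGpd

end

theorem mainTheorem7
    {E : Type*} [NormedAddCommGroup E] [NormedSpace ℝ E] [FiniteDimensional ℝ E]
    {M : Type*} [TopologicalSpace M] [T2Space M] [SecondCountableTopology M]
    [ChartedSpace E M] [IsManifold 𝓘(ℝ, E) ∞ M]
    {F : Type*} [NormedAddCommGroup F] [NormedSpace ℝ F] [FiniteDimensional ℝ F]
    {G : Type*} [TopologicalSpace G] [ChartedSpace F G] [IsManifold 𝓘(ℝ, F) ∞ G]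
    (Γ : LieGpd.LieGroupoid E M F G) (hΓ : Γ.GConnected) (x₀ : M)
    (η : Γ.closedBasicForms) :
    ((∃ f : M → Circle, ContMDiff 𝓘(ℝ, E) (𝓡 1) ∞ f ∧ Γ.IsBasicMap f ∧
        LieGpd.IsPullbackAngle η.1 f) ↔
      Γ.IsIntegral x₀ (Γ.basicClass η)) ∧
    (Γ.IsIntegral x₀ (Γ.basicClass η) ↔
      ∀ σ : Γ.GPath x₀ x₀, ∃ k : ℤ, σ.integral η.1 = k) := by
  have h12 := fun h : ∃ f : M → Circle, ContMDiff 𝓘(ℝ, E) (𝓡 1) ∞ f ∧ Γ.IsBasicMap f ∧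
      LieGpd.IsPullbackAngle η.1 f =>
    LieGpd.LieGroupoid.isIntegral_of_isPullbackAngle x₀ h.choose_spec.1 h.choose_spec.2.1
      h.choose_spec.2.2
  have h23 : Γ.IsIntegral x₀ (Γ.basicClass η) →
      ∀ σ : Γ.GPath x₀ x₀, ∃ k : ℤ, σ.integral η.1 = k := by
    rintro ⟨P, hP, hk⟩ σ
    exact hP η rfl σ ▸ hk _
  have h31 := LieGpd.LieGroupoid.exists_isPullbackAngle hΓ x₀ η
  exact ⟨⟨h12, fun h => h31 (h23 h)⟩, ⟨h23, fun h => h12 (h31 h)⟩⟩
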